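/- Let $\Omega\subset\mathbb R^3$ be a bounded open set and $\Omega^-$ an open set with $\overline{\Omega^-}\subset\Omega$ whose boundary $\Gamma=\partial\Omega^-$ is a $C^2$ surface (with $\Omega^-$ on one side of it) with unit normal $\vec n$ pointing out of $\Omega^-$; put $\Omega^+=\Omega\setminus\overline{\Omega^-}$. Let $\mu^\pm$ be constants and let $p^\pm,\vec u^\pm$ be of class $C^2$ and $\vec g^\pm$ of class $C^1$ on $\Omega^\pm$ up to $\Gamma$, with $\vec u^\pm$ of class $C^3$ in the interior, such that in $\Omega^\pm$ $$\nabla p^\pm=\mu^\pm\nabla^2\vec u^\pm+\vec g^\pm,\qquad \nabla\cdot\vec u^\pm=0 .$$ On $\Gamma$ suppose that $\vec u^+=\vec u^-=\vec q$, that $\nabla_s\cdot\vec q=0$, and that $(\sigma^+-\sigma^-)\vec n=\vec f$, where $\sigma^\pm=-p^\pm I+\mu^\pm\big(\nabla\vec u^\pm+(\nabla\vec u^\pm)^T\big)$. Here $\nabla_s=(I-\vec n\otimes\vec n)\nabla$ is the surface gradient, $\nabla_s\cdot$ the surface divergence, $\nabla_s^2=\nabla_s\cdot\nabla_s$ the surface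 Laplacian (componentwise on vectors), and $H=\nabla_s\cdot\vec n$ the total curvature. At $\vec x\in\Gamma$ the jump of a quantity $F$ is $[F]=\lim_{\varepsilon\to0^+}F^+(\vec x+\varepsilon\vec n)-\lim_{\varepsilon\to0^+}F^-(\vec x-\varepsilon\vec n)$, and $\partial/\partial n$, $\partial^2/\partial n^2$ are the first and second derivatives in the fixed direction $\vec n=\vec n(\vec x)$. Then all surface derivatives and jumps (with their one-sided limits) below exist, and at every point of $\Gamma$ $$\left[\frac{\partial^2p}{\partial n^2}\right]=\nabla_s^2(\vec f\cdot\vec n)+[\nabla\cdot\vec g]-\left[\frac{\partial p}{\partial n}\right]H,$$ where the jump in the first normal derivative of the pressure is given by $$\left[\frac{\partial p}{\partial n}\right]=2[\mu]\Big(\vec n\cdot\nabla_s^2\vec q+\kappa_t\frac{\partial\vec q}{\partial t}\cdot\vec t+\kappa_b\frac{\partial\vec q}{\partial b}\cdot\vec b\Big)-\nabla_s\cdot\vec f+(\vec f\cdot\vec n)H+[\vec g]\cdot\vec n$$ with $[\mu]=\mu^+-\mu^-$, for any orthonormal tangent vectors $\vec t,\vec b$ along principal directions of $\Gamma$ at the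 point, with principal curvatures $\kappa_t,\kappa_b$ in the sense $\partial\vec n/\partial t=\kappa_t\vec t$, $\partial\vec n/\partial b=\kappa_b\vec b$. -/

import Mathlib

open Set Filter Topology

noncomputable section

namespace StokesJump

/-- Three-dimensional Euclidean space. -/
abbrev E3 : Type := EuclideanSpace ℝ (Fin 3)

/-- The standard basis vectors of `E3`. -/
def e (i : Fin 3) : E3 := EuclideanSpace.single i 1

/-! ### Differential operators in the bulk -/

/-- The divergence `∇·V` of a vector field. -/
def divergence (V : E3 → E3) (y : E3) : ℝ :=
  ∑ i, (fderiv ℝ V y (e i)) i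

/-- The derivative of `φ` at `y` in the fixed direction `ν`. -/
def dirDeriv (ν : E3) (φ : E3 → ℝ) (y : E3) : ℝ :=
  fderiv ℝ φ y ν

/-- The vector `σ ν`, where `σ = -p I + μ (∇u + (∇u)ᵀ)` is the stress tensor at `y`. -/
def stressVec (μ : ℝ) (p : E3 → ℝ) (u : E3 → E3) (ν y : E3) : E3 :=
  -(p y) • ν +
    μ • (fderiv ℝ u y ν + ContinuousLinearMap.adjoint (fderiv ℝ u y) ν)

/-! ### Surface operators

`Γ` is a surface and `n` a unit normal field on it.  A derivative within `Γ` is determined only in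
the directions tangent to `Γ`; it is always preceded or followed by the tangential projection
`I - n ⊗ n`, so that the operators below depend only on the values of the fields on `Γ`. -/

/-- The tangential projection `(I - n(x) ⊗ n(x)) v`. -/
def tangProj (n : E3 → E3) (x v : E3) : E3 :=
  v - inner ℝ (n x) v • n x

/-- The surface gradient `∇_s φ = (I - n ⊗ n) ∇φ`. -/
def surfGrad (Γ : Set E3) (n : E3 → E3) (φ : E3 → ℝ) (x : E3) : E3 :=
  tangProj n x (gradientWithin φ Γ x)

/-- The surface divergence `∇_s · V`, the trace of `∇V` composed with `I - n ⊗ n`. -/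
def surfDiv (Γ : Set E3) (n : E3 → E3) (V : E3 → E3) (x : E3) : ℝ :=
  ∑ i, (fderivWithin ℝ V Γ x (tangProj n x (e i))) i

/-- The surface Laplacian `∇_s² φ = ∇_s · ∇_s φ` of a scalar field. -/
def surfLap (Γ : Set E3) (n : E3 → E3) (φ : E3 → ℝ) (x : E3) : ℝ :=
  surfDiv Γ n (surfGrad Γ n φ) x

/-- The surface Laplacian of a vector field, taken on each Cartesian component. -/
def surfLapVec (Γ : Set E3) (n : E3 → E3) (V : E3 → E3) (x : E3) : E3 :=
  ∑ i, surfLap Γ n (fun y => V y i) x • e i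

/-- The total curvature `H = ∇_s · n` (the sum of the principal curvatures; `2 / R` on a sphere of
radius `R` with outward normal). -/
def totalCurvature (Γ : Set E3) (n : E3 → E3) (x : E3) : ℝ :=
  surfDiv Γ n n x

/-- A scalar field on `Γ` is twice differentiable along `Γ`. -/
def SurfTwiceDifferentiable (Γ : Set E3) (n : E3 → E3) (φ : E3 → ℝ) : Prop :=
  DifferentiableOn ℝ φ Γ ∧ DifferentiableOn ℝ (surfGrad Γ n φ) Γ

/-- `(n(x), t, b)` is an orthonormal frame whose tangent vectors `t`, `b` lie along principal
directions of `Γ` at `x`, with principal curvatures `κt`, `κb`: `∂n/∂t = κt t`, `∂n/∂b = κb b`. -/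
structure IsPrincipalFrame (Γ : Set E3) (n : E3 → E3) (x t b : E3) (κt κb : ℝ) : Prop where
  norm_t : ‖t‖ = 1
  norm_b : ‖b‖ = 1
  t_perp_n : inner ℝ t (n x) = 0
  b_perp_n : inner ℝ b (n x) = 0
  t_perp_b : inner ℝ t b = 0
  deriv_t : fderivWithin ℝ n Γ x t = κt • t
  deriv_b : fderivWithin ℝ n Γ x b = κb • b

/-! ### The interface, the two phases and jumps -/

/-- `Ωm` is an open set with closure in the bounded open set `Ω`, whose boundary
`Γ = frontier Ωm` is a `C²` surface with outward unit normal `n`: near each point of `Γ` there is a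
`C²` function `φ` with nonvanishing gradient such that `Ωm = {φ < 0}`, `Γ = {φ = 0}` and
`n = ∇φ / ‖∇φ‖` on `Γ`. -/
structure IsInterface (Ω Ωm : Set E3) (n : E3 → E3) : Prop where
  isOpen_domain : IsOpen Ω
  isBounded_domain : Bornology.IsBounded Ω
  isOpen_inner : IsOpen Ωm
  closure_subset : closure Ωm ⊆ Ω
  local_defining : ∀ x ∈ frontier Ωm, ∃ (U : Set E3) (φ : E3 → ℝ),
    IsOpen U ∧ x ∈ U ∧ ContDiffOn ℝ 2 φ U ∧
    (∀ y ∈ U, gradient φ y ≠ 0) ∧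
    (∀ y ∈ U, y ∈ Ωm ↔ φ y < 0) ∧
    (∀ y ∈ U, y ∈ frontier Ωm ↔ φ y = 0) ∧
    (∀ y ∈ U ∩ frontier Ωm, n y = ‖gradient φ y‖⁻¹ • gradient φ y)

/-- The outer region `Ω⁺`, the part of `Ω` outside the interface. -/
def outer (Ω Ωm : Set E3) : Set E3 := Ω \ closure Ωm

/-- `(p, u)` is a classical solution, in the open set `D`, of the Stokes equations
`∇p = μ ∇²u + g`, `∇·u = 0` with constant viscosity `μ` and body force `g`, with `u`, `p` of class
`C²` and `g` of class `C¹` in `D` up to the part `Γ` of its boundary, and `u` of class `C³` in the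
interior. -/
structure IsStokesFlow (D Γ : Set E3) (μ : ℝ) (p : E3 → ℝ) (u g : E3 → E3) : Prop where
  pressure_reg : ContDiffOn ℝ 2 p (D ∪ Γ)
  velocity_reg : ContDiffOn ℝ 2 u (D ∪ Γ)
  velocity_reg_interior : ContDiffOn ℝ 3 u D
  force_reg : ContDiffOn ℝ 1 g (D ∪ Γ)
  momentum : ∀ y ∈ D, gradient p y = μ • Laplacian.laplacian u y + g y
  incompressible : ∀ y ∈ D, divergence u y = 0

/-- `[F] = J` at the interface point `x` with normal `ν`, where `F` is `Fp` on the outer side and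
`Fm` on the inner side: both limits exist and
`J = lim_{ε → 0⁺} Fp (x + ε ν) - lim_{ε → 0⁺} Fm (x - ε ν)`. -/
def HasJump {V : Type*} [AddCommGroup V] [Module ℝ V] [TopologicalSpace V]
    (Fp Fm : E3 → V) (x ν : E3) (J : V) : Prop :=
  ∃ a b : V, Tendsto (fun ε : ℝ => Fp (x + ε • ν)) (𝓝[>] 0) (𝓝 a) ∧
    Tendsto (fun ε : ℝ => Fm (x - ε • ν)) (𝓝[>] 0) (𝓝 b) ∧ J = a - b

end StokesJump

end

/-! One-sided limits at the interface are realized as derivatives within `D ∪ Γ`, where `D` is a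
phase. This set has unique derivatives, so derivatives of the fields are continuous up to `Γ` and an
identity valid in `D` passes to `Γ` (`IsSide.eqOn`). The tangent plane lies in the tangent cone of
`Γ`, so surface operators may be computed on these boundary values with any ambient derivative,
applied to tangent vectors.

Let A and B be the first and second one-sided derivatives of u, and T = (A + Aᵀ)n the viscous
traction. From ∇·u = 0 and ∇_s·q = 0 follows n·An = 0, so T is tangential and f = -[p] n + [μT]; in
particular f·n = -[p].

Second normal derivative: along `Γ`, ∇_s²F is the tangential trace of the Hessian minus H ∂F/∂n
(`IsOrientedSurface.surfLap_eq`). This is applied to F = p⁻ - p⁺ = f·n. The tangential trace is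
eliminated by ∇²p = ∇·g, the divergence of the momentum equation, in which ∇·∇²u = 0.

First normal derivative: the normal momentum balance leaves n·∇²u to be found. Since B(n) is trace
free and B is symmetric, n·B(n,n) is the negative of a sum over tangent directions, and that sum
occurs in ∇_s·T. Hence n·∇²u is twice a surface expression in q minus ∇_s·T
(`IsStokesFlow.inner_normal_laplacian`). Multiplying by μ± and subtracting turns the tractions into
∇_s·f - (f·n)H. -/

noncomputable section

namespace StokesJump

/-! ### Tangent cones of level sets and of one-sided neighbourhoods -/

section Geometry

variable {E : Type*} [NormedAddCommGroup E] [NormedSpace ℝ E]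

/-- A function vanishing at `x` is positive along rays in directions of positive derivative. -/
theorem eventually_pos_along_ray {φ : E → ℝ} {L : E →L[ℝ] ℝ} {x v : E}
    (hφ : HasFDerivAt φ L x) (h0 : φ x = 0) (hv : 0 < L v) :
    ∀ᶠ ε : ℝ in 𝓝[>] 0, 0 < φ (x + ε • v) := by
  have hd : HasDerivAt (fun ε : ℝ => φ (x + ε • v)) (L v) 0 := by
    have h1 : HasDerivAt (fun ε : ℝ => x + ε • v) v 0 := by
      simpa using ((hasDerivAt_id (0 : ℝ)).smul_const v).const_add x
    have h2 : HasFDerivAt φ L (x + (0 : ℝ) • v) := by simpa using hφ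
    exact h2.comp_hasDerivAt 0 h1
  have hs := hd.tendsto_slope_zero_right
  filter_upwards [hs.eventually (lt_mem_nhds hv), self_mem_nhdsWithin] with ε h1 h2
  simp only [zero_add, zero_smul, add_zero, h0, sub_zero, smul_eq_mul] at h1
  exact (pos_iff_pos_of_mul_pos h1).1 (inv_pos.2 h2)

/-- The kernel of the derivative of a defining function lies in the tangent cone of its zero
set. -/
theorem mem_tangentConeAt_of_zeroSet {φ : E → ℝ} {L : E →L[ℝ] ℝ} {x v : E} {U Γ : Set E}
    (hU : U ∈ 𝓝 x) (hc : ContinuousOn φ U) (hΓ : ∀ y ∈ U, φ y = 0 → y ∈ Γ)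
    (hφ : HasFDerivAt φ L x) (h0 : φ x = 0) (hL : L ≠ 0) (hv : L v = 0) :
    v ∈ tangentConeAt ℝ Γ x := by
  obtain ⟨a, ha⟩ : ∃ a, 0 < L a := by
    obtain ⟨a, ha⟩ : ∃ a, L a ≠ 0 := by
      by_contra! h
      exact hL (ContinuousLinearMap.ext h)
    rcases ha.lt_or_gt with h | h
    · exact ⟨-a, by simpa using h⟩
    · exact ⟨a, h⟩
  -- In the direction v + s a the derivative of φ is s L(a). For small ε it follows that φ has
  -- opposite signs at s = δ and s = -δ, and the intermediate value theorem gives a zero between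
  -- them. Letting δ → 0 yields points of `Γ` approaching x in the direction v.
  have key : ∀ δ : ℝ, 0 < δ → ∃ ε s : ℝ, 0 < ε ∧ ε < δ ∧ |s| ≤ δ ∧ x + ε • (v + s • a) ∈ Γ := by
    intro δ hδ
    have h1 := eventually_pos_along_ray (v := v + δ • a) hφ h0 (by
      simp only [map_add, map_smul, hv, smul_eq_mul, zero_add]; positivity)
    have h2 := eventually_pos_along_ray (φ := fun y => - φ y) (v := v + (-δ) • a) hφ.neg
      (by simp [h0]) (by
        simp only [map_add, map_smul, hv, smul_eq_mul, neg_apply]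
        nlinarith [mul_pos hδ ha])
    -- Compactness in s gives one ε for the whole segment, so that φ is continuous along it.
    have h3 : ∀ᶠ ε : ℝ in 𝓝[>] 0, ∀ s ∈ Icc (-δ) δ, x + ε • (v + s • a) ∈ U := by
      have hK : IsCompact (Icc (-δ) δ) := isCompact_Icc
      have hcont : Continuous fun z : ℝ × ℝ => x + z.1 • (v + z.2 • a) := by fun_prop
      have : ∀ᶠ ε : ℝ in 𝓝 0, ∀ s ∈ Icc (-δ) δ, x + ε • (v + s • a) ∈ U := by
        apply hK.eventually_forall_of_forall_eventually
        intro s _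
        have := hcont.tendsto ((0 : ℝ), s)
        simp only [zero_smul, add_zero] at this
        exact this.eventually hU
      exact this.filter_mono nhdsWithin_le_nhds
    have h4 : ∀ᶠ ε : ℝ in 𝓝[>] 0, ε < δ :=
      (gt_mem_nhds hδ).filter_mono nhdsWithin_le_nhds
    obtain ⟨ε, hε1, hε2, hε3, hε4, hε⟩ :=
      (h1.and (h2.and (h3.and (h4.and self_mem_nhdsWithin)))).exists
    have hcs : ContinuousOn (fun s : ℝ => φ (x + ε • (v + s • a))) (Icc (-δ) δ) :=
      hc.comp (by fun_prop) hε3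
    obtain ⟨s, hs, hs0⟩ := intermediate_value_Icc (by linarith : -δ ≤ δ) hcs
      (show (0 : ℝ) ∈ Icc _ _ from ⟨by linarith, hε1.le⟩)
    exact ⟨ε, s, hε, hε4, abs_le.2 hs, hΓ _ (hε3 s hs) hs0⟩
  choose! ε s h1 h2 h3 h4 using key
  let r : ℕ → ℝ := fun k => 1 / ((k : ℝ) + 1)
  have hr : ∀ k, 0 < r k := fun k => by positivity
  have hr0 : Tendsto r atTop (𝓝 0) := tendsto_one_div_add_atTop_nhds_zero_nat
  have hε0 : Tendsto (fun k => ε (r k)) atTop (𝓝 0) :=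
    squeeze_zero (fun k => (h1 _ (hr k)).le) (fun k => (h2 _ (hr k)).le) hr0
  have hs0 : Tendsto (fun k => s (r k)) atTop (𝓝 0) :=
    squeeze_zero_norm (fun k => h3 _ (hr k)) hr0
  have hva : Tendsto (fun k => v + s (r k) • a) atTop (𝓝 v) := by
    simpa using (hs0.smul_const a).const_add v
  refine mem_tangentConeAt_of_seq atTop (fun k => (ε (r k))⁻¹)
    (fun k => ε (r k) • (v + s (r k) • a)) ?_ (Eventually.of_forall fun k => h4 _ (hr k)) ?_
  · simpa using hε0.smul hva
  · refine hva.congr fun k => ?_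
    rw [inv_smul_smul₀ (h1 _ (hr k)).ne']

/-- A set containing initial pieces of all rays into an open half-space at `x` has unique
derivatives at `x`. -/
theorem uniqueDiffWithinAt_of_halfSpace {D S : Set E} {L : E →L[ℝ] ℝ} {x : E} (hL : L ≠ 0)
    (hD : ∀ v, 0 < L v → ∀ᶠ ε : ℝ in 𝓝[>] 0, x + ε • v ∈ D) (hDS : D ⊆ S) (hx : x ∈ S) :
    UniqueDiffWithinAt ℝ S x := by
  obtain ⟨a, ha⟩ : ∃ a, 0 < L a := by
    obtain ⟨a, ha⟩ : ∃ a, L a ≠ 0 := by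
      by_contra! h
      exact hL (ContinuousLinearMap.ext h)
    rcases ha.lt_or_gt with h | h
    · exact ⟨-a, by simpa using h⟩
    · exact ⟨a, h⟩
  have hmem : ∀ v, 0 < L v → v ∈ tangentConeAt ℝ S x := fun v hv =>
    mem_tangentConeAt_of_add_smul_mem (tendsto_id'.2 (nhdsGT_le_nhdsNE (0 : ℝ))) ((hD v hv).mono fun _ h => hDS h)
  refine ⟨?_, subset_closure hx⟩
  have : Submodule.span ℝ (tangentConeAt ℝ S x) = ⊤ := by
    rw [eq_top_iff]
    intro w _
    -- This c makes L(w + c a) = L w + |L w| + 1 positive, so w is a difference of two vectors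
    -- spanned by directions of the open half-space.
    set c := (|L w| + 1) / L a
    have hc : c * L a = |L w| + 1 := div_mul_cancel₀ _ ha.ne'
    have h1 : w + c • a ∈ Submodule.span ℝ (tangentConeAt ℝ S x) := by
      refine Submodule.subset_span (hmem _ ?_)
      rw [map_add, map_smul, smul_eq_mul, hc]
      linarith [neg_abs_le (L w)]
    have h2 := Submodule.smul_mem _ c (Submodule.subset_span (hmem a ha))
    simpa using Submodule.sub_mem _ h1 h2
  rw [this]
  exact dense_univ

end Geometry

/-! ### The interface as an oriented surface with two sides -/

/-- `Γ` is a surface with differentiable unit normal field `n`, in the sense needed for the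
differential calculus within `Γ`. -/
structure IsOrientedSurface (Γ : Set E3) (n : E3 → E3) : Prop where
  norm_normal : ∀ x ∈ Γ, ‖n x‖ = 1
  differentiableOn_normal : DifferentiableOn ℝ n Γ
  mem_tangentCone : ∀ x ∈ Γ, ∀ v, inner ℝ (n x) v = 0 → v ∈ tangentConeAt ℝ Γ x

/-- `D` is an open set lying locally on the side of `Γ` into which `ν` points. -/
structure IsSide (D Γ : Set E3) (ν : E3 → E3) : Prop where
  isOpen : IsOpen D
  normal_ne_zero : ∀ x ∈ Γ, ν x ≠ 0
  eventually_mem : ∀ x ∈ Γ, ∀ v, 0 < inner ℝ (ν x) v → ∀ᶠ ε : ℝ in 𝓝[>] 0, x + ε • v ∈ D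

/-- Makes derivatives within `D ∪ Γ` well defined at the points of `Γ`, where they serve as
one-sided derivatives. -/
theorem IsSide.uniqueDiffOn {D Γ : Set E3} {ν : E3 → E3} (h : IsSide D Γ ν) :
    UniqueDiffOn ℝ (D ∪ Γ) := by
  rintro x (hx | hx)
  · exact (h.isOpen.uniqueDiffWithinAt hx).mono subset_union_left
  · refine uniqueDiffWithinAt_of_halfSpace (D := D) (L := innerSL ℝ (ν x)) ?_ ?_
      subset_union_left (Or.inr hx)
    · intro h0
      have := congrArg (fun L => L (ν x)) h0
      simp at this
      exact h.normal_ne_zero x hx this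
    · simpa using h.eventually_mem x hx

/-- The local description of an interface by a defining function. -/
theorem IsInterface.exists_defining {Ω Ωm : Set E3} {n : E3 → E3} (h : IsInterface Ω Ωm n)
    {x : E3} (hx : x ∈ frontier Ωm) :
    ∃ (U : Set E3) (φ : E3 → ℝ) (c : ℝ), U ∈ 𝓝 x ∧ U ⊆ Ω ∧ ContDiffOn ℝ 2 φ U ∧ φ x = 0 ∧ 0 < c ∧
      HasFDerivAt φ (c • innerSL ℝ (n x)) x ∧ ‖n x‖ = 1 ∧ DifferentiableWithinAt ℝ n (frontier Ωm) x
      ∧ (∀ y ∈ U, y ∈ Ωm ↔ φ y < 0) ∧ (∀ y ∈ U, y ∈ frontier Ωm ↔ φ y = 0) := by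
  obtain ⟨U, φ, hU, hxU, hφ, hg, hneg, hzero, hn⟩ := h.local_defining x hx
  have hdiff : DifferentiableAt ℝ φ x :=
    (hφ.differentiableOn (by norm_num)).differentiableAt (hU.mem_nhds hxU)
  have hpos : 0 < ‖gradient φ x‖ := norm_pos_iff.2 (hg x hxU)
  have hnx := hn x ⟨hxU, hx⟩
  -- Intersecting with Ω, which is open and contains the interface, later places nearby points with
  -- φ > 0 in the outer phase.
  refine ⟨U ∩ Ω, φ, ‖gradient φ x‖, ?_, inter_subset_right, hφ.mono inter_subset_left,
    (hzero x hxU).1 hx, hpos, ?_, ?_, ?_, fun y hy => hneg y hy.1, fun y hy => hzero y hy.1⟩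
  · exact inter_mem (hU.mem_nhds hxU)
      (h.isOpen_domain.mem_nhds (h.closure_subset (frontier_subset_closure hx)))
  · have := hdiff.hasGradientAt.hasFDerivAt
    have heq : ‖gradient φ x‖ • innerSL ℝ (n x)
        = InnerProductSpace.toDual ℝ E3 (gradient φ x) := by
      refine ContinuousLinearMap.ext fun v => ?_
      rw [hnx, smul_apply, innerSL_apply_apply, InnerProductSpace.toDual_apply_apply,
        real_inner_smul_left, smul_eq_mul, mul_inv_cancel_left₀ hpos.ne']
    rwa [heq]
  · rw [hnx, norm_smul, norm_inv, norm_norm, inv_mul_cancel₀ hpos.ne']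
  · have h1 : ContDiffAt ℝ 1 (fderiv ℝ φ) x :=
      (hφ.contDiffAt (hU.mem_nhds hxU)).fderiv_right (by norm_num)
    have h2 : DifferentiableAt ℝ (gradient φ) x :=
      ((InnerProductSpace.toDual ℝ E3).symm.toContinuousLinearEquiv.differentiableAt).comp x
        (h1.differentiableAt (by norm_num))
    have h3 : DifferentiableAt ℝ (fun y => ‖gradient φ y‖⁻¹ • gradient φ y) x :=
      ((h2.norm ℝ (hg x hxU)).inv hpos.ne').smul h2
    refine h3.differentiableWithinAt.congr_of_eventuallyEq ?_ hnx
    filter_upwards [self_mem_nhdsWithin, mem_nhdsWithin_of_mem_nhds (hU.mem_nhds hxU)] with y h1 h2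
    exact hn y ⟨h2, h1⟩

theorem IsInterface.isOrientedSurface {Ω Ωm : Set E3} {n : E3 → E3} (h : IsInterface Ω Ωm n) :
    IsOrientedSurface (frontier Ωm) n where
  norm_normal x hx := by
    obtain ⟨U, φ, c, -, -, -, -, -, -, h1, -⟩ := h.exists_defining hx
    exact h1
  differentiableOn_normal x hx := by
    obtain ⟨U, φ, c, -, -, -, -, -, -, -, h1, -⟩ := h.exists_defining hx
    exact h1
  mem_tangentCone x hx v hv := by
    obtain ⟨U, φ, c, hU, -, hφ, h0, hc, hd, hn, -, -, hz⟩ := h.exists_defining hx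
    refine mem_tangentConeAt_of_zeroSet hU hφ.continuousOn (fun y hy => (hz y hy).2) hd h0 ?_ ?_
    · intro hL
      have := congrArg (fun L => L (n x)) hL
      simp [hn, hc.ne'] at this
    · simp [hv]

theorem IsInterface.isSide_inner {Ω Ωm : Set E3} {n : E3 → E3} (h : IsInterface Ω Ωm n) :
    IsSide Ωm (frontier Ωm) (-n) where
  isOpen := h.isOpen_inner
  normal_ne_zero x hx := by
    have := h.isOrientedSurface.norm_normal x hx
    intro h0
    rw [Pi.neg_apply, neg_eq_zero] at h0
    simp [h0] at this
  eventually_mem x hx v hv := by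
    obtain ⟨U, φ, c, hU, -, -, h0, hc, hd, -, -, hm, -⟩ := h.exists_defining hx
    have hmem : Tendsto (fun ε : ℝ => x + ε • v) (𝓝[>] 0) (𝓝 x) := by
      have : Continuous fun ε : ℝ => x + ε • v := by fun_prop
      simpa using (this.tendsto 0).mono_left nhdsWithin_le_nhds
    have hv' : 0 < (-(c • innerSL ℝ (n x))) v := by
      simp only [Pi.neg_apply, inner_neg_left] at hv
      simp only [neg_apply, smul_apply, innerSL_apply_apply,
        smul_eq_mul]
      nlinarith
    filter_upwards [eventually_pos_along_ray hd.neg (by simp [h0]) hv', hmem.eventually hU]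
      with ε h1 h2
    exact (hm _ h2).2 (by simpa using h1)

theorem IsInterface.isSide_outer {Ω Ωm : Set E3} {n : E3 → E3} (h : IsInterface Ω Ωm n) :
    IsSide (outer Ω Ωm) (frontier Ωm) n where
  isOpen := h.isOpen_domain.sdiff isClosed_closure
  normal_ne_zero x hx := by
    have := h.isOrientedSurface.norm_normal x hx
    intro h0
    simp [h0] at this
  eventually_mem x hx v hv := by
    obtain ⟨U, φ, c, hU, hUΩ, -, h0, hc, hd, -, -, hm, hz⟩ := h.exists_defining hx
    have hmem : Tendsto (fun ε : ℝ => x + ε • v) (𝓝[>] 0) (𝓝 x) := by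
      have : Continuous fun ε : ℝ => x + ε • v := by fun_prop
      simpa using (this.tendsto 0).mono_left nhdsWithin_le_nhds
    have hv' : 0 < (c • innerSL ℝ (n x)) v := by
      simp only [smul_apply, innerSL_apply_apply, smul_eq_mul]
      positivity
    filter_upwards [eventually_pos_along_ray hd h0 hv', hmem.eventually hU] with ε h1 h2
    refine ⟨hUΩ h2, ?_⟩
    rw [closure_eq_self_union_frontier]
    rintro (h3 | h3)
    · exact absurd ((hm _ h2).1 h3) h1.le.not_gt
    · exact h1.ne' ((hz _ h2).1 h3)

/-! ### Orthonormal frames, traces and adjoints -/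

theorem inner_e_left (v : E3) (i : Fin 3) : inner ℝ (e i) v = v i := by
  simp [e, EuclideanSpace.inner_single_left]

theorem sum_apply_e_eq_inner (M : E3 →L[ℝ] E3) (w : OrthonormalBasis (Fin 3) ℝ E3) :
    ∑ i, (M (e i)) i = inner ℝ (M (w 0)) (w 0) + inner ℝ (M (w 1)) (w 1)
      + inner ℝ (M (w 2)) (w 2) := by
  have h1 := LinearMap.trace_eq_sum_inner (M : E3 →ₗ[ℝ] E3) (EuclideanSpace.basisFun (Fin 3) ℝ)
  have h2 := LinearMap.trace_eq_sum_inner (M : E3 →ₗ[ℝ] E3) w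
  rw [h1] at h2
  have h3 : ∀ i, inner ℝ (EuclideanSpace.basisFun (Fin 3) ℝ i)
      ((M : E3 →ₗ[ℝ] E3) (EuclideanSpace.basisFun (Fin 3) ℝ i)) = (M (e i)) i := by
    intro i
    rw [EuclideanSpace.basisFun_apply]
    exact inner_e_left _ i
  simp only [h3] at h2
  rw [h2, Fin.sum_univ_three]
  simp only [ContinuousLinearMap.coe_coe, real_inner_comm]

theorem exists_orthonormalBasis_zero_eq {ν : E3} (hν : ‖ν‖ = 1) :
    ∃ w : OrthonormalBasis (Fin 3) ℝ E3, w 0 = ν := by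
  have hv : Orthonormal ℝ (({0} : Set (Fin 3)).domRestrict fun _ => ν) := by
    constructor
    · intro i
      simpa using hν
    · rintro ⟨i, hi⟩ ⟨j, hj⟩ hij
      exact absurd (Subtype.ext (hi.trans hj.symm)) hij
  obtain ⟨w, hw⟩ := hv.exists_orthonormalBasis_extension_of_card_eq (by simp)
  exact ⟨w, hw 0 rfl⟩

theorem exists_orthonormalBasis_eq {ν t b : E3} (hν : ‖ν‖ = 1) (ht : ‖t‖ = 1) (hb : ‖b‖ = 1)
    (htν : inner ℝ t ν = 0) (hbν : inner ℝ b ν = 0) (htb : inner ℝ t b = 0) :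
    ∃ w : OrthonormalBasis (Fin 3) ℝ E3, w 0 = ν ∧ w 1 = t ∧ w 2 = b := by
  have hv : Orthonormal ℝ ((univ : Set (Fin 3)).domRestrict ![ν, t, b]) := by
    constructor
    · rintro ⟨i, -⟩
      fin_cases i <;> simpa
    · rintro ⟨i, hi⟩ ⟨j, hj⟩ hij
      have h0 : inner ℝ ν t = 0 := by rw [real_inner_comm, htν]
      have h1 : inner ℝ ν b = 0 := by rw [real_inner_comm, hbν]
      have h2 : inner ℝ b t = 0 := by rw [real_inner_comm, htb]
      have hij' : i ≠ j := fun h => hij (Subtype.ext h)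
      fin_cases i <;> fin_cases j <;> first
        | exact absurd rfl hij'
        | assumption
  obtain ⟨w, hw⟩ := hv.exists_orthonormalBasis_extension_of_card_eq (by simp)
  exact ⟨w, hw 0 trivial, hw 1 trivial, hw 2 trivial⟩

/-- The adjoint as a continuous linear map on the space of endomorphisms. -/
def adjointL : (E3 →L[ℝ] E3) →L[ℝ] (E3 →L[ℝ] E3) :=
  LinearMap.toContinuousLinearMap
    { toFun := fun A => ContinuousLinearMap.adjoint A
      map_add' := fun A B => map_add _ A B
      map_smul' := fun c A => by simp }

theorem adjointL_apply (A : E3 →L[ℝ] E3) : adjointL A = ContinuousLinearMap.adjoint A := rfl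

theorem inner_adjointL (A : E3 →L[ℝ] E3) (v w : E3) :
    inner ℝ (adjointL A v) w = inner ℝ v (A w) :=
  ContinuousLinearMap.adjoint_inner_left A w v

/-! ### Surface calculus through ambient derivatives -/

section Surface

variable {Γ : Set E3} {n : E3 → E3} {x : E3} {w : OrthonormalBasis (Fin 3) ℝ E3}

theorem inner_basis (w : OrthonormalBasis (Fin 3) ℝ E3) (i j : Fin 3) :
    inner ℝ (w i) (w j) = if i = j then (1 : ℝ) else 0 :=
  orthonormal_iff_ite.1 w.orthonormal i j

/-- Derivatives within `Γ` are not unique, but any two agree on the tangent cone, which contains the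
plane orthogonal to n. This is why the choice made by `fderivWithin` does not matter in surface
operators. -/
theorem IsOrientedSurface.fderivWithin_apply {F : Type*} [NormedAddCommGroup F] [NormedSpace ℝ F]
    (h : IsOrientedSurface Γ n) (hx : x ∈ Γ) {V : E3 → F} {L : E3 →L[ℝ] F}
    (hV : HasFDerivWithinAt V L Γ x) {v : E3} (hv : inner ℝ (n x) v = 0) :
    fderivWithin ℝ V Γ x v = L v :=
  hV.differentiableWithinAt.hasFDerivWithinAt.unique_on hV (h.mem_tangentCone x hx v hv)

theorem IsOrientedSurface.inner_tangProj (h : IsOrientedSurface Γ n) (hx : x ∈ Γ) (v : E3) :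
    inner ℝ (n x) (tangProj n x v) = 0 := by
  rw [tangProj, inner_sub_right, real_inner_smul_right, real_inner_self_eq_norm_sq,
    h.norm_normal x hx]
  ring

/-- The tangential projection as a continuous linear map. -/
def tangProjL (ν : E3) : E3 →L[ℝ] E3 :=
  ContinuousLinearMap.id ℝ E3 - (innerSL ℝ ν).smulRight ν

theorem tangProjL_apply (v : E3) : tangProjL (n x) v = tangProj n x v := rfl

theorem tangProj_basis_zero (hw : w 0 = n x) : tangProj n x (w 0) = 0 := by
  rw [tangProj, ← hw, inner_basis]
  simp

theorem tangProj_basis_of_ne (hw : w 0 = n x) {i : Fin 3} (hi : i ≠ 0) :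
    tangProj n x (w i) = w i := by
  rw [tangProj, ← hw, inner_basis, if_neg hi.symm]
  simp

/-- The surface divergence as a trace over an orthonormal basis of the tangent plane. -/
theorem IsOrientedSurface.surfDiv_eq (h : IsOrientedSurface Γ n) (hx : x ∈ Γ) {V : E3 → E3}
    {L : E3 →L[ℝ] E3} (hV : HasFDerivWithinAt V L Γ x) (hw : w 0 = n x) :
    surfDiv Γ n V x = inner ℝ (L (w 1)) (w 1) + inner ℝ (L (w 2)) (w 2) := by
  have h1 : surfDiv Γ n V x = ∑ i, ((L.comp (tangProjL (n x))) (e i)) i := by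
    refine Finset.sum_congr rfl fun i _ => ?_
    rw [h.fderivWithin_apply hx hV (h.inner_tangProj hx _)]
    rfl
  rw [h1, sum_apply_e_eq_inner _ w]
  simp only [ContinuousLinearMap.comp_apply, tangProjL_apply, tangProj_basis_zero hw,
    tangProj_basis_of_ne hw (show (1 : Fin 3) ≠ 0 by decide),
    tangProj_basis_of_ne hw (show (2 : Fin 3) ≠ 0 by decide)]
  simp

theorem IsOrientedSurface.totalCurvature_eq (h : IsOrientedSurface Γ n) (hx : x ∈ Γ)
    (hw : w 0 = n x) :
    totalCurvature Γ n x = inner ℝ (fderivWithin ℝ n Γ x (w 1)) (w 1)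
      + inner ℝ (fderivWithin ℝ n Γ x (w 2)) (w 2) :=
  h.surfDiv_eq hx (h.differentiableOn_normal x hx).hasFDerivWithinAt hw

theorem IsOrientedSurface.surfGrad_eq (h : IsOrientedSurface Γ n) (hx : x ∈ Γ) {F : E3 → ℝ}
    {G : E3} (hF : HasFDerivWithinAt F (innerSL ℝ G) Γ x) :
    surfGrad Γ n F x = G - inner ℝ (n x) G • n x := by
  refine ext_inner_right ℝ fun v => ?_
  have h1 : inner ℝ (surfGrad Γ n F x) v = inner ℝ (gradientWithin F Γ x) (tangProj n x v) := by
    simp only [surfGrad, tangProj, inner_sub_left, inner_sub_right,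
      real_inner_smul_right, real_inner_comm]
    ring
  have h2 : inner ℝ (gradientWithin F Γ x) (tangProj n x v)
      = fderivWithin ℝ F Γ x (tangProj n x v) := by
    rw [← InnerProductSpace.toDual_apply_apply (𝕜 := ℝ), toDual_gradientWithin]
  rw [h1, h2, h.fderivWithin_apply hx hF (h.inner_tangProj hx v), innerSL_apply_apply]
  simp only [tangProj, inner_sub_left, inner_sub_right,
    real_inner_smul_right, real_inner_comm]
  ring

/-- The product rule for G - (n·G)n. The term with the derivative of n produces the curvature in the
surface Laplacian; the term along n drops out when paired with tangent vectors. -/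
theorem IsOrientedSurface.hasFDerivWithinAt_surfGrad (h : IsOrientedSurface Γ n) (hx : x ∈ Γ)
    {F : E3 → ℝ} {G : E3 → E3} {Q : E3 →L[ℝ] E3}
    (hF : ∀ y ∈ Γ, HasFDerivWithinAt F (innerSL ℝ (G y)) Γ y)
    (hG : HasFDerivWithinAt G Q Γ x) :
    ∃ L : E3 →L[ℝ] E3, HasFDerivWithinAt (surfGrad Γ n F) L Γ x ∧
      ∀ v, L v = Q v - (inner ℝ (n x) (G x) • fderivWithin ℝ n Γ x v
        + (inner ℝ (n x) (Q v) + inner ℝ (fderivWithin ℝ n Γ x v) (G x)) • n x) := by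
  have hn := (h.differentiableOn_normal x hx).hasFDerivWithinAt
  have h1 := hG.sub ((hn.inner ℝ hG).smul hn)
  refine ⟨_, h1.congr (fun y hy => h.surfGrad_eq hy (hF y hy)) (h.surfGrad_eq hx (hF x hx)), ?_⟩
  intro v
  simp

/-- Existence of the second surface derivatives of a field with a differentiable gradient. -/
theorem IsOrientedSurface.surfTwiceDifferentiable (h : IsOrientedSurface Γ n)
    {F : E3 → ℝ} {G : E3 → E3} (hF : ∀ y ∈ Γ, HasFDerivWithinAt F (innerSL ℝ (G y)) Γ y)
    (hG : DifferentiableOn ℝ G Γ) : SurfTwiceDifferentiable Γ n F := by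
  refine ⟨fun y hy => (hF y hy).differentiableWithinAt, fun y hy => ?_⟩
  obtain ⟨L, hL, -⟩ := h.hasFDerivWithinAt_surfGrad hy hF (hG y hy).hasFDerivWithinAt
  exact hL.differentiableWithinAt

/-- The surface Laplacian in terms of the gradient and Hessian of an ambient extension. -/
theorem IsOrientedSurface.surfLap_eq (h : IsOrientedSurface Γ n) (hx : x ∈ Γ)
    {F : E3 → ℝ} {G : E3 → E3} {Q : E3 →L[ℝ] E3}
    (hF : ∀ y ∈ Γ, HasFDerivWithinAt F (innerSL ℝ (G y)) Γ y)
    (hG : HasFDerivWithinAt G Q Γ x) (hw : w 0 = n x) :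
    surfLap Γ n F x = inner ℝ (Q (w 1)) (w 1) + inner ℝ (Q (w 2)) (w 2)
      - inner ℝ (n x) (G x) * totalCurvature Γ n x := by
  obtain ⟨L, hL, hLv⟩ := h.hasFDerivWithinAt_surfGrad hx hF hG
  rw [surfLap, h.surfDiv_eq hx hL hw, h.totalCurvature_eq hx hw, hLv, hLv]
  simp only [inner_sub_left, inner_add_left, real_inner_smul_left, ← hw, inner_basis]
  simp
  ring

theorem hasFDerivWithinAt_component {V : E3 → E3} {A : E3 →L[ℝ] E3}
    (hV : HasFDerivWithinAt V A Γ x) (i : Fin 3) :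
    HasFDerivWithinAt (fun y => V y i) (innerSL ℝ (adjointL A (e i))) Γ x := by
  have h1 := ((EuclideanSpace.proj i : E3 →L[ℝ] ℝ).hasFDerivAt (x := V x)).comp_hasFDerivWithinAt
    x hV
  refine h1.congr_fderiv (ContinuousLinearMap.ext fun v => ?_)
  rw [innerSL_apply_apply, inner_adjointL, inner_e_left]
  rfl

/-- The surface Laplacian of a vector field in terms of the first and second derivatives of an
ambient extension. -/
theorem IsOrientedSurface.surfLapVec_eq (h : IsOrientedSurface Γ n) (hx : x ∈ Γ)
    {V : E3 → E3} {A : E3 → E3 →L[ℝ] E3} {B : E3 →L[ℝ] E3 →L[ℝ] E3}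
    (hV : ∀ y ∈ Γ, HasFDerivWithinAt V (A y) Γ y)
    (hA : HasFDerivWithinAt A B Γ x) (hw : w 0 = n x) :
    surfLapVec Γ n V x = B (w 1) (w 1) + B (w 2) (w 2) - totalCurvature Γ n x • A x (n x) := by
  have hi : ∀ i, surfLap Γ n (fun y => V y i) x
      = (B (w 1) (w 1) + B (w 2) (w 2) - totalCurvature Γ n x • A x (n x)) i := by
    intro i
    -- The i-th component has ambient gradient Aᵀ eᵢ, which is linear in A and so differentiable
    -- along with it.
    have hG : HasFDerivWithinAt (fun y => adjointL (A y) (e i))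
        ((adjointL.comp B).flip (e i)) Γ x := by
      have := (adjointL.hasFDerivAt.comp_hasFDerivWithinAt x hA).clm_apply
        (hasFDerivWithinAt_const (e i) x Γ)
      exact this.congr_fderiv (ContinuousLinearMap.ext fun v => by simp)
    rw [h.surfLap_eq hx (fun y hy => hasFDerivWithinAt_component (hV y hy) i) hG hw,
      real_inner_comm _ (n x), inner_adjointL]
    simp only [ContinuousLinearMap.flip_apply, ContinuousLinearMap.comp_apply, inner_adjointL,
      inner_e_left]
    simp [mul_comm]
  ext j
  simp only [surfLapVec, hi]
  simp [e, Fin.sum_univ_three]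
  fin_cases j <;> simp

/-- The derivative along `Γ` of the viscous traction `(∇V + (∇V)ᵀ) n`. -/
theorem IsOrientedSurface.hasFDerivWithinAt_traction (h : IsOrientedSurface Γ n) (hx : x ∈ Γ)
    {A : E3 → E3 →L[ℝ] E3} {B : E3 →L[ℝ] E3 →L[ℝ] E3} (hA : HasFDerivWithinAt A B Γ x) :
    ∃ L : E3 →L[ℝ] E3,
      HasFDerivWithinAt (fun y => A y (n y) + adjointL (A y) (n y)) L Γ x ∧
      ∀ v, L v = (A x (fderivWithin ℝ n Γ x v) + B v (n x))
        + (adjointL (A x) (fderivWithin ℝ n Γ x v) + adjointL (B v) (n x)) := by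
  have hn := (h.differentiableOn_normal x hx).hasFDerivWithinAt
  have h1 := hA.clm_apply hn
  have h2 := (adjointL.hasFDerivAt.comp_hasFDerivWithinAt x hA).clm_apply hn
  refine ⟨_, h1.add h2, fun v => ?_⟩
  simp

/-- In the product rule the term with the derivative of ψ is parallel to n, so it has no tangential
trace. -/
theorem IsOrientedSurface.surfDiv_smul_normal (h : IsOrientedSurface Γ n) (hx : x ∈ Γ)
    {ψ : E3 → ℝ} (hψ : DifferentiableWithinAt ℝ ψ Γ x) :
    surfDiv Γ n (fun y => ψ y • n y) x = ψ x * totalCurvature Γ n x := by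
  obtain ⟨w, hw⟩ := exists_orthonormalBasis_zero_eq (h.norm_normal x hx)
  have hn := (h.differentiableOn_normal x hx).hasFDerivWithinAt
  rw [h.surfDiv_eq (V := fun y => ψ y • n y) hx (hψ.hasFDerivWithinAt.smul hn) hw, h.totalCurvature_eq hx hw]
  simp only [add_apply, smul_apply, ContinuousLinearMap.smulRight_apply, inner_add_left,
    real_inner_smul_left, ← hw, inner_basis]
  simp
  ring

theorem IsOrientedSurface.surfDiv_linear (h : IsOrientedSurface Γ n) (hx : x ∈ Γ)
    {V V' : E3 → E3} (hV : DifferentiableWithinAt ℝ V Γ x) (hV' : DifferentiableWithinAt ℝ V' Γ x)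
    (c c' : ℝ) : surfDiv Γ n (fun y => c • V y + c' • V' y) x
      = c * surfDiv Γ n V x + c' * surfDiv Γ n V' x := by
  obtain ⟨w, hw⟩ := exists_orthonormalBasis_zero_eq (h.norm_normal x hx)
  rw [h.surfDiv_eq (V := fun y => c • V y + c' • V' y) hx
    ((hV.hasFDerivWithinAt.const_smul c).add (hV'.hasFDerivWithinAt.const_smul c')) hw, h.surfDiv_eq hx hV.hasFDerivWithinAt hw,
    h.surfDiv_eq hx hV'.hasFDerivWithinAt hw]
  simp only [add_apply, smul_apply, inner_add_left, real_inner_smul_left]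
  ring

end Surface

/-! ### Trace, divergence and Laplacian -/

/-- The trace as a continuous linear functional. -/
def traceL : (E3 →L[ℝ] E3) →L[ℝ] ℝ :=
  ∑ i : Fin 3, (EuclideanSpace.proj i : E3 →L[ℝ] ℝ).comp
    (ContinuousLinearMap.apply ℝ E3 (e i))

theorem traceL_apply (M : E3 →L[ℝ] E3) : traceL M = ∑ i, (M (e i)) i := by
  simp [traceL]

theorem traceL_eq_inner (M : E3 →L[ℝ] E3) (w : OrthonormalBasis (Fin 3) ℝ E3) :
    traceL M = inner ℝ (M (w 0)) (w 0) + inner ℝ (M (w 1)) (w 1) + inner ℝ (M (w 2)) (w 2) := by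
  rw [traceL_apply, sum_apply_e_eq_inner M w]

theorem divergence_eq_traceL (V : E3 → E3) (y : E3) : divergence V y = traceL (fderiv ℝ V y) :=
  (traceL_apply _).symm

theorem laplacian_eq_fderiv_fderiv (u : E3 → E3) (y : E3) (w : OrthonormalBasis (Fin 3) ℝ E3) :
    Laplacian.laplacian u y = fderiv ℝ (fderiv ℝ u) y (w 0) (w 0)
      + fderiv ℝ (fderiv ℝ u) y (w 1) (w 1) + fderiv ℝ (fderiv ℝ u) y (w 2) (w 2) := by
  rw [InnerProductSpace.laplacian_eq_iteratedFDeriv_orthonormalBasis u w]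
  simp [iteratedFDeriv_two_apply, Fin.sum_univ_three]

/-! ### Divergence-free fields in the interior -/

section Interior

variable {D : Set E3} {u : E3 → E3}

/-- The derivative of a divergence-free field has trace-free derivatives. -/
theorem traceL_fderiv_fderiv_eq_zero (hD : IsOpen D) (hu : ContDiffOn ℝ 2 u D)
    (hdiv : ∀ y ∈ D, divergence u y = 0) {y : E3} (hy : y ∈ D) (a : E3) :
    traceL (fderiv ℝ (fderiv ℝ u) y a) = 0 := by
  have hA : DifferentiableAt ℝ (fderiv ℝ u) y :=
    ((hu.contDiffAt (hD.mem_nhds hy)).fderiv_right (m := 1) (by norm_num)).differentiableAt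
      (by norm_num)
  have h1 := traceL.hasFDerivAt.comp y hA.hasFDerivAt
  have h2 : (⇑traceL ∘ fderiv ℝ u) =ᶠ[𝓝 y] fun _ => 0 := by
    filter_upwards [hD.mem_nhds hy] with z hz
    rw [Function.comp_apply, ← divergence_eq_traceL, hdiv z hz]
  have h3 := h1.unique ((hasFDerivAt_const (0 : ℝ) y).congr_of_eventuallyEq h2)
  exact congrArg (fun L => L a) h3

/-- The Laplacian of a divergence-free field is divergence free. -/
theorem divergence_laplacian_eq_zero (hD : IsOpen D) (hu : ContDiffOn ℝ 3 u D)
    (hdiv : ∀ y ∈ D, divergence u y = 0) {y : E3} (hy : y ∈ D) :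
    DifferentiableAt ℝ (Laplacian.laplacian u) y ∧ divergence (Laplacian.laplacian u) y = 0 := by
  obtain ⟨w, -⟩ := exists_orthonormalBasis_zero_eq (ν := e 0) (by simp [e])
  have hA : ContDiffOn ℝ 2 (fderiv ℝ u) D := hu.fderiv_of_isOpen hD (by norm_num)
  have hB : ContDiffOn ℝ 1 (fderiv ℝ (fderiv ℝ u)) D := hA.fderiv_of_isOpen hD (by norm_num)
  have hB' : HasFDerivAt (fderiv ℝ (fderiv ℝ u)) (fderiv ℝ (fderiv ℝ (fderiv ℝ u)) y) y :=
    ((hB.contDiffAt (hD.mem_nhds hy)).differentiableAt (by norm_num)).hasFDerivAt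
  set T := fderiv ℝ (fderiv ℝ (fderiv ℝ u)) y
  have happ : ∀ a b : E3, HasFDerivAt (fun z => fderiv ℝ (fderiv ℝ u) z a b)
      ((T.flip a).flip b) y := by
    intro a b
    have h1 := (hB'.clm_apply (hasFDerivAt_const a y)).clm_apply (hasFDerivAt_const b y)
    exact h1.congr_fderiv (ContinuousLinearMap.ext fun v => by simp)
  have hs12 : ∀ a b, T a b = T b a := by
    intro a b
    exact (hA.contDiffAt (hD.mem_nhds hy)).isSymmSndFDerivAt (by simp) a b
  have hs23 : ∀ a b c, T a b c = T a c b := by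
    intro a b c
    have h2 : (fun z => fderiv ℝ (fderiv ℝ u) z b c) =ᶠ[𝓝 y]
        fun z => fderiv ℝ (fderiv ℝ u) z c b := by
      filter_upwards [hD.mem_nhds hy] with z hz
      exact ((hu.contDiffAt (hD.mem_nhds hz)).of_le (by norm_num)).isSymmSndFDerivAt (n := 2)
        (by simp) b c
    have := (happ b c).unique ((happ c b).congr_of_eventuallyEq h2)
    exact congrArg (fun L => L a) this
  have htr : ∀ a b, traceL (T a b) = 0 := by
    intro a b
    have h1 := traceL.hasFDerivAt.comp y (hB'.clm_apply (hasFDerivAt_const b y))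
    have h2 : (⇑traceL ∘ fun z => fderiv ℝ (fderiv ℝ u) z b) =ᶠ[𝓝 y] fun _ => 0 := by
      filter_upwards [hD.mem_nhds hy] with z hz
      exact traceL_fderiv_fderiv_eq_zero hD (hu.of_le (by norm_num)) hdiv hz b
    have h3 := h1.unique ((hasFDerivAt_const (0 : ℝ) y).congr_of_eventuallyEq h2)
    simpa using congrArg (fun L => L a) h3
  have hlap : HasFDerivAt (Laplacian.laplacian u) ((T.flip (w 0)).flip (w 0)
      + (T.flip (w 1)).flip (w 1) + (T.flip (w 2)).flip (w 2)) y := by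
    have h1 := ((happ (w 0) (w 0)).add (happ (w 1) (w 1))).add (happ (w 2) (w 2))
    have h2 : Laplacian.laplacian u = fun z => fderiv ℝ (fderiv ℝ u) z (w 0) (w 0)
      + fderiv ℝ (fderiv ℝ u) z (w 1) (w 1) + fderiv ℝ (fderiv ℝ u) z (w 2) (w 2) :=
      funext fun z => laplacian_eq_fderiv_fderiv u z w
    rw [h2]
    exact h1
  refine ⟨hlap.differentiableAt, ?_⟩
  rw [divergence_eq_traceL, hlap.fderiv]
  -- Total symmetry of the third derivative: T(v,k,k) = T(k,k,v). The divergence of the Laplacian is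
  -- thus the sum of the traces of T(k,k), each zero because u is divergence free.
  have hk : ∀ k, (T.flip (w k)).flip (w k) = T (w k) (w k) := by
    intro k
    refine ContinuousLinearMap.ext fun v => ?_
    rw [ContinuousLinearMap.flip_apply, ContinuousLinearMap.flip_apply, hs12, hs23]
  rw [hk, hk, hk, map_add, map_add, htr, htr, htr]
  simp

end Interior

/-! ### Passage to the boundary from one side -/

section Side

variable {D Γ : Set E3} {ν : E3 → E3} {x : E3}

/-- The ray from x along ν(x) enters `D`, so continuity of ψ up to `Γ` identifies the one-sided
limit of φ with the boundary value of ψ. -/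
theorem IsSide.tendsto (h : IsSide D Γ ν) (hx : x ∈ Γ) {F : Type*} [TopologicalSpace F]
    {φ ψ : E3 → F} (hψ : ContinuousOn ψ (D ∪ Γ)) (heq : ∀ y ∈ D, φ y = ψ y) :
    Tendsto (fun ε : ℝ => φ (x + ε • ν x)) (𝓝[>] 0) (𝓝 (ψ x)) := by
  have hpos : 0 < inner ℝ (ν x) (ν x) := by
    rw [real_inner_self_eq_norm_sq]
    have := norm_pos_iff.2 (h.normal_ne_zero x hx)
    positivity
  have hD := h.eventually_mem x hx _ hpos
  have h0 : Tendsto (fun ε : ℝ => x + ε • ν x) (𝓝[>] 0) (𝓝[D ∪ Γ] x) := by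
    refine tendsto_nhdsWithin_iff.2 ⟨?_, hD.mono fun _ h => Or.inl h⟩
    have : Continuous fun ε : ℝ => x + ε • ν x := by fun_prop
    simpa using (this.tendsto 0).mono_left nhdsWithin_le_nhds
  refine ((hψ x (Or.inr hx)).tendsto.comp h0).congr' ?_
  filter_upwards [hD] with ε hε
  exact (heq _ hε).symm

/-- Continuous fields that agree in `D` agree up to the boundary part `Γ`. -/
theorem IsSide.eqOn (h : IsSide D Γ ν) {F : Type*} [TopologicalSpace F] [T2Space F]
    {φ ψ : E3 → F} (hφ : ContinuousOn φ (D ∪ Γ)) (hψ : ContinuousOn ψ (D ∪ Γ))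
    (heq : ∀ y ∈ D, φ y = ψ y) : ∀ y ∈ D ∪ Γ, φ y = ψ y := by
  rintro y (hy | hy)
  · exact heq y hy
  · exact tendsto_nhds_unique (h.tendsto hy hφ fun _ _ => rfl) (h.tendsto hy hψ heq)

theorem IsSide.mem_nhds (h : IsSide D Γ ν) {y : E3} (hy : y ∈ D) : D ∪ Γ ∈ 𝓝 y :=
  mem_of_superset (h.isOpen.mem_nhds hy) subset_union_left

theorem IsSide.mem_closure_interior (h : IsSide D Γ ν) (hx : x ∈ Γ) :
    x ∈ closure (interior (D ∪ Γ)) := by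
  have hpos : 0 < inner ℝ (ν x) (ν x) := by
    rw [real_inner_self_eq_norm_sq]
    have := norm_pos_iff.2 (h.normal_ne_zero x hx)
    positivity
  have h0 : Tendsto (fun ε : ℝ => x + ε • ν x) (𝓝[>] 0) (𝓝 x) := by
    have : Continuous fun ε : ℝ => x + ε • ν x := by fun_prop
    simpa using (this.tendsto 0).mono_left nhdsWithin_le_nhds
  refine mem_closure_of_tendsto h0 ((h.eventually_mem x hx _ hpos).mono fun _ hy => ?_)
  exact interior_maximal subset_union_left h.isOpen hy

variable {F : Type*} [NormedAddCommGroup F] [NormedSpace ℝ F] {V : E3 → F}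

theorem IsSide.fderivWithin_eq (h : IsSide D Γ ν) {y : E3} (hy : y ∈ D) :
    fderiv ℝ V y = fderivWithin ℝ V (D ∪ Γ) y :=
  (fderivWithin_of_mem_nhds (h.mem_nhds hy)).symm

theorem IsSide.fderivWithin_fderivWithin_eq (h : IsSide D Γ ν) {y : E3} (hy : y ∈ D) :
    fderiv ℝ (fderiv ℝ V) y = fderivWithin ℝ (fderivWithin ℝ V (D ∪ Γ)) (D ∪ Γ) y :=
  (fderivWithin_fderivWithin_eq_of_mem_nhds (h.mem_nhds hy)).symm

theorem IsSide.contDiffOn_fderivWithin (h : IsSide D Γ ν) (hV : ContDiffOn ℝ 2 V (D ∪ Γ)) :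
    ContDiffOn ℝ 1 (fderivWithin ℝ V (D ∪ Γ)) (D ∪ Γ) :=
  hV.fderivWithin h.uniqueDiffOn (by norm_num)

theorem IsSide.hasFDerivWithinAt (_h : IsSide D Γ ν) (hV : ContDiffOn ℝ 1 V (D ∪ Γ)) (hx : x ∈ Γ) :
    HasFDerivWithinAt V (fderivWithin ℝ V (D ∪ Γ) x) Γ x :=
  ((hV.differentiableOn (by norm_num)) x (Or.inr hx)).hasFDerivWithinAt.mono subset_union_right

theorem IsSide.continuousOn_fderivWithin (h : IsSide D Γ ν) (hV : ContDiffOn ℝ 1 V (D ∪ Γ)) :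
    ContinuousOn (fderivWithin ℝ V (D ∪ Γ)) (D ∪ Γ) :=
  hV.continuousOn_fderivWithin h.uniqueDiffOn (by norm_num)

theorem IsSide.symm (h : IsSide D Γ ν) (hV : ContDiffOn ℝ 2 V (D ∪ Γ)) (hx : x ∈ Γ) (a b : E3) :
    fderivWithin ℝ (fderivWithin ℝ V (D ∪ Γ)) (D ∪ Γ) x a b
      = fderivWithin ℝ (fderivWithin ℝ V (D ∪ Γ)) (D ∪ Γ) x b a :=
  (hV x (Or.inr hx)).isSymmSndFDerivWithinAt (by simp) h.uniqueDiffOn (h.mem_closure_interior hx)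
    (Or.inr hx) a b

end Side

/-! ### The Stokes equations up to the interface -/

section Flow

variable {D Γ : Set E3} {ν : E3 → E3} {x : E3} {μ : ℝ} {p : E3 → ℝ} {u g : E3 → E3}

theorem IsStokesFlow.traceL_fderivWithin (hf : IsStokesFlow D Γ μ p u g) (h : IsSide D Γ ν) :
    ∀ y ∈ D ∪ Γ, traceL (fderivWithin ℝ u (D ∪ Γ) y) = 0 := by
  refine h.eqOn (φ := fun y => traceL (fderivWithin ℝ u (D ∪ Γ) y)) (ψ := fun _ => 0)
    (traceL.continuous.comp_continuousOn
      (h.continuousOn_fderivWithin (hf.velocity_reg.of_le (by norm_num))))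
    continuousOn_const fun y hy => ?_
  rw [← h.fderivWithin_eq hy, ← divergence_eq_traceL, hf.incompressible y hy]

theorem IsStokesFlow.traceL_fderivWithin_fderivWithin (hf : IsStokesFlow D Γ μ p u g)
    (h : IsSide D Γ ν) (a : E3) : ∀ y ∈ D ∪ Γ,
      traceL (fderivWithin ℝ (fderivWithin ℝ u (D ∪ Γ)) (D ∪ Γ) y a) = 0 := by
  refine h.eqOn
    (φ := fun y => traceL (fderivWithin ℝ (fderivWithin ℝ u (D ∪ Γ)) (D ∪ Γ) y a))
    (ψ := fun _ => 0)
    (traceL.continuous.comp_continuousOn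
      ((h.continuousOn_fderivWithin (h.contDiffOn_fderivWithin hf.velocity_reg)).clm_apply
        continuousOn_const))
    continuousOn_const fun y hy => ?_
  rw [← h.fderivWithin_fderivWithin_eq hy, traceL_fderiv_fderiv_eq_zero h.isOpen
    (hf.velocity_reg.mono subset_union_left) hf.incompressible hy]

/-- The momentum equation holds up to the interface. -/
theorem IsStokesFlow.momentum_boundary (hf : IsStokesFlow D Γ μ p u g)
    (h : IsSide D Γ ν) (w : OrthonormalBasis (Fin 3) ℝ E3) : ∀ y ∈ D ∪ Γ,
      gradientWithin p (D ∪ Γ) y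
        = μ • (fderivWithin ℝ (fderivWithin ℝ u (D ∪ Γ)) (D ∪ Γ) y (w 0) (w 0)
          + fderivWithin ℝ (fderivWithin ℝ u (D ∪ Γ)) (D ∪ Γ) y (w 1) (w 1)
          + fderivWithin ℝ (fderivWithin ℝ u (D ∪ Γ)) (D ∪ Γ) y (w 2) (w 2)) + g y := by
  have hB := h.continuousOn_fderivWithin (h.contDiffOn_fderivWithin hf.velocity_reg)
  have hk : ∀ k, ContinuousOn (fun y =>
      fderivWithin ℝ (fderivWithin ℝ u (D ∪ Γ)) (D ∪ Γ) y (w k) (w k)) (D ∪ Γ) := fun k =>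
    (hB.clm_apply continuousOn_const).clm_apply continuousOn_const
  refine h.eqOn ?_ ?_ fun y hy => ?_
  · exact (InnerProductSpace.toDual ℝ E3).symm.continuous.comp_continuousOn
      (h.continuousOn_fderivWithin (hf.pressure_reg.of_le (by norm_num)))
  · exact ((((hk 0).add (hk 1)).add (hk 2)).const_smul μ).add hf.force_reg.continuousOn
  · rw [← h.fderivWithin_fderivWithin_eq hy, ← laplacian_eq_fderiv_fderiv, ← hf.momentum y hy,
      gradientWithin, gradient, h.fderivWithin_eq hy]

theorem hasFDerivAt_gradient {y : E3} (hp : ContDiffAt ℝ 2 p y) :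
    ∃ Q : E3 →L[ℝ] E3, HasFDerivAt (gradient p) Q y ∧
      ∀ a b, inner ℝ (Q a) b = fderiv ℝ (fderiv ℝ p) y a b := by
  have h1 : DifferentiableAt ℝ (fderiv ℝ p) y :=
    (hp.fderiv_right (m := 1) (by norm_num)).differentiableAt (by norm_num)
  have h2 := (InnerProductSpace.toDual ℝ E3).symm.toContinuousLinearEquiv.hasFDerivAt.comp y
    h1.hasFDerivAt
  refine ⟨_, h2, fun a b => ?_⟩
  simp [← InnerProductSpace.toDual_apply_apply (𝕜 := ℝ)]

/-- Up to the interface, the Laplacian of the pressure is the divergence of the force. -/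
theorem IsStokesFlow.laplacian_pressure (hf : IsStokesFlow D Γ μ p u g)
    (h : IsSide D Γ ν) (w : OrthonormalBasis (Fin 3) ℝ E3) : ∀ y ∈ D ∪ Γ,
      fderivWithin ℝ (fderivWithin ℝ p (D ∪ Γ)) (D ∪ Γ) y (w 0) (w 0)
          + fderivWithin ℝ (fderivWithin ℝ p (D ∪ Γ)) (D ∪ Γ) y (w 1) (w 1)
          + fderivWithin ℝ (fderivWithin ℝ p (D ∪ Γ)) (D ∪ Γ) y (w 2) (w 2)
        = traceL (fderivWithin ℝ g (D ∪ Γ) y) := by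
  have hB := h.continuousOn_fderivWithin (h.contDiffOn_fderivWithin hf.pressure_reg)
  have hk : ∀ k, ContinuousOn (fun y =>
      fderivWithin ℝ (fderivWithin ℝ p (D ∪ Γ)) (D ∪ Γ) y (w k) (w k)) (D ∪ Γ) := fun k =>
    (hB.clm_apply continuousOn_const).clm_apply continuousOn_const
  refine h.eqOn (((hk 0).add (hk 1)).add (hk 2))
    (traceL.continuous.comp_continuousOn (h.continuousOn_fderivWithin hf.force_reg))
    fun y hy => ?_
  rw [← h.fderivWithin_fderivWithin_eq hy, ← h.fderivWithin_eq hy]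
  have hnhds := h.isOpen.mem_nhds hy
  obtain ⟨Q, hQ, hQ'⟩ := hasFDerivAt_gradient
    ((hf.pressure_reg.mono subset_union_left).contDiffAt hnhds)
  obtain ⟨hl, hl0⟩ := divergence_laplacian_eq_zero h.isOpen hf.velocity_reg_interior
    hf.incompressible hy
  have hg : DifferentiableAt ℝ g y :=
    ((hf.force_reg.mono subset_union_left).contDiffAt hnhds).differentiableAt (by norm_num)
  have h1 : HasFDerivAt (fun z => μ • Laplacian.laplacian u z + g z)
      (μ • fderiv ℝ (Laplacian.laplacian u) y + fderiv ℝ g y) y :=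
    (hl.hasFDerivAt.const_smul μ).add hg.hasFDerivAt
  have h2 : gradient p =ᶠ[𝓝 y] fun z => μ • Laplacian.laplacian u z + g z := by
    filter_upwards [hnhds] with z hz
    exact hf.momentum z hz
  -- The Hessian of p is the derivative of the right side of the momentum equation; its trace is ∇·g
  -- because ∇·∇²u = 0.
  have h3 := hQ.unique (h1.congr_of_eventuallyEq h2)
  rw [← hQ', ← hQ', ← hQ', ← traceL_eq_inner, h3, map_add, map_smul, ← divergence_eq_traceL, hl0]
  simp

end Flow

/-! ### Jumps as differences of boundary values -/

section Jump

variable {Dp Dm Γ : Set E3} {n : E3 → E3} {x : E3}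

theorem HasJump.of_isSide {F : Type*} [AddCommGroup F] [Module ℝ F] [TopologicalSpace F]
    (hp : IsSide Dp Γ n) (hm : IsSide Dm Γ (-n)) (hx : x ∈ Γ) {φp φm ψp ψm : E3 → F}
    (hψp : ContinuousOn ψp (Dp ∪ Γ)) (hψm : ContinuousOn ψm (Dm ∪ Γ))
    (hpe : ∀ y ∈ Dp, φp y = ψp y) (hme : ∀ y ∈ Dm, φm y = ψm y) :
    HasJump φp φm x (n x) (ψp x - ψm x) := by
  refine ⟨ψp x, ψm x, hp.tendsto hx hψp hpe, ?_, rfl⟩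
  simpa [sub_eq_add_neg] using hm.tendsto hx hψm hme

theorem HasJump.unique {F : Type*} [AddCommGroup F] [Module ℝ F] [TopologicalSpace F] [T2Space F]
    {φp φm : E3 → F} {ν : E3} {J J' : F} (h : HasJump φp φm x ν J) (h' : HasJump φp φm x ν J') :
    J = J' := by
  obtain ⟨a, b, ha, hb, rfl⟩ := h
  obtain ⟨a', b', ha', hb', rfl⟩ := h'
  rw [tendsto_nhds_unique ha ha', tendsto_nhds_unique hb hb']

end Jump

theorem dirDeriv_dirDeriv_eq {D : Set E3} {p : E3 → ℝ} (hD : IsOpen D) (hp : ContDiffOn ℝ 2 p D)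
    {y : E3} (hy : y ∈ D) (a : E3) :
    dirDeriv a (dirDeriv a p) y = fderiv ℝ (fderiv ℝ p) y a a := by
  have h1 : DifferentiableAt ℝ (fderiv ℝ p) y :=
    ((hp.contDiffAt (hD.mem_nhds hy)).fderiv_right (m := 1) (by norm_num)).differentiableAt
      (by norm_num)
  have h2 := h1.hasFDerivAt.clm_apply (hasFDerivAt_const a y)
  have h3 : dirDeriv a p = fun z => fderiv ℝ p z a := rfl
  rw [dirDeriv, h3, h2.fderiv]
  simp

theorem surfDiv_congr {Γ : Set E3} {n V V' : E3 → E3} {x : E3} (hx : x ∈ Γ)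
    (h : ∀ y ∈ Γ, V y = V' y) : surfDiv Γ n V x = surfDiv Γ n V' x := by
  simp only [surfDiv, fderivWithin_congr h (h x hx)]

/-! ### Interface conditions and the traction -/

/-- The viscous traction `(∇u + (∇u)ᵀ) n` on `Γ`, with `∇u` the one-sided derivative from `D`. -/
def traction (D Γ : Set E3) (n u : E3 → E3) (y : E3) : E3 :=
  fderivWithin ℝ u (D ∪ Γ) y (n y) + adjointL (fderivWithin ℝ u (D ∪ Γ) y) (n y)

section Flow

variable {D Γ : Set E3} {n ν : E3 → E3} {x : E3} {μ : ℝ} {p : E3 → ℝ} {u g q : E3 → E3}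

/-- On `Γ` the field q is the trace of u, so either phase supplies an ambient derivative for it. -/
theorem IsStokesFlow.hasFDerivWithinAt_velocity (hf : IsStokesFlow D Γ μ p u g)
    (h : IsSide D Γ ν) (hq : ∀ y ∈ Γ, u y = q y) (hx : x ∈ Γ) :
    HasFDerivWithinAt q (fderivWithin ℝ u (D ∪ Γ) x) Γ x :=
  (h.hasFDerivWithinAt (hf.velocity_reg.of_le (by norm_num)) hx).congr
    (fun y hy => (hq y hy).symm) (hq x hx).symm

/-- If the interface is incompressible, so that `∇_s · u = 0`, there is no normal stretching. -/
theorem IsStokesFlow.inner_fderivWithin_normal (hf : IsStokesFlow D Γ μ p u g)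
    (hΓ : IsOrientedSurface Γ n) (h : IsSide D Γ ν) (hq : ∀ y ∈ Γ, u y = q y)
    (hinc : ∀ y ∈ Γ, surfDiv Γ n q y = 0) (hx : x ∈ Γ) :
    inner ℝ (fderivWithin ℝ u (D ∪ Γ) x (n x)) (n x) = 0 := by
  obtain ⟨w, hw⟩ := exists_orthonormalBasis_zero_eq (hΓ.norm_normal x hx)
  have h1 := hf.traceL_fderivWithin h x (Or.inr hx)
  have h2 := hinc x hx
  rw [hΓ.surfDiv_eq hx (hf.hasFDerivWithinAt_velocity h hq hx) hw] at h2
  rw [traceL_eq_inner _ w, hw] at h1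
  linarith

/-- Both halves of the traction have normal component n·An, which vanishes. Hence only the pressure
contributes to f·n. -/
theorem IsStokesFlow.inner_traction_normal (hf : IsStokesFlow D Γ μ p u g)
    (hΓ : IsOrientedSurface Γ n) (h : IsSide D Γ ν) (hq : ∀ y ∈ Γ, u y = q y)
    (hinc : ∀ y ∈ Γ, surfDiv Γ n q y = 0) (hx : x ∈ Γ) :
    inner ℝ (traction D Γ n u x) (n x) = 0 := by
  rw [traction, inner_add_left, inner_adjointL, real_inner_comm _ (n x),
    hf.inner_fderivWithin_normal hΓ h hq hinc hx, add_zero]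

theorem IsStokesFlow.differentiableWithinAt_traction (hf : IsStokesFlow D Γ μ p u g)
    (hΓ : IsOrientedSurface Γ n) (h : IsSide D Γ ν) (hx : x ∈ Γ) :
    DifferentiableWithinAt ℝ (traction D Γ n u) Γ x := by
  obtain ⟨L, hL, -⟩ := hΓ.hasFDerivWithinAt_traction hx
    (h.hasFDerivWithinAt (h.contDiffOn_fderivWithin hf.velocity_reg) hx)
  exact hL.differentiableWithinAt

/-- The normal component of the one-sided Laplacian of the velocity, expressed by surface
derivatives of the interface velocity and of the viscous traction. -/
theorem IsStokesFlow.inner_normal_laplacian (hf : IsStokesFlow D Γ μ p u g)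
    (hΓ : IsOrientedSurface Γ n) (h : IsSide D Γ ν) (hq : ∀ y ∈ Γ, u y = q y)
    (hinc : ∀ y ∈ Γ, surfDiv Γ n q y = 0) (hx : x ∈ Γ)
    {w : OrthonormalBasis (Fin 3) ℝ E3} (hw : w 0 = n x) {κt κb : ℝ}
    (ht : fderivWithin ℝ n Γ x (w 1) = κt • w 1) (hb : fderivWithin ℝ n Γ x (w 2) = κb • w 2) :
    inner ℝ (n x) (fderivWithin ℝ (fderivWithin ℝ u (D ∪ Γ)) (D ∪ Γ) x (w 0) (w 0)
        + fderivWithin ℝ (fderivWithin ℝ u (D ∪ Γ)) (D ∪ Γ) x (w 1) (w 1)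
        + fderivWithin ℝ (fderivWithin ℝ u (D ∪ Γ)) (D ∪ Γ) x (w 2) (w 2))
      = 2 * (inner ℝ (n x) (surfLapVec Γ n q x)
          + κt * inner ℝ (fderivWithin ℝ q Γ x (w 1)) (w 1)
          + κb * inner ℝ (fderivWithin ℝ q Γ x (w 2)) (w 2))
        - surfDiv Γ n (traction D Γ n u) x := by
  have hA := h.hasFDerivWithinAt (h.contDiffOn_fderivWithin hf.velocity_reg) hx
  have hV : ∀ y ∈ Γ, HasFDerivWithinAt q (fderivWithin ℝ u (D ∪ Γ) y) Γ y := fun y hy =>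
    hf.hasFDerivWithinAt_velocity h hq hy
  have hstretch := hf.inner_fderivWithin_normal hΓ h hq hinc hx
  have htr := hf.traceL_fderivWithin_fderivWithin h (n x) x (Or.inr hx)
  have hsymm := h.symm hf.velocity_reg hx
  have hperp : ∀ i : Fin 3, i ≠ 0 → inner ℝ (n x) (w i) = 0 := fun i hi => by
    rw [← hw, inner_basis, if_neg hi.symm]
  obtain ⟨L, hL, hLv⟩ := hΓ.hasFDerivWithinAt_traction hx hA
  rw [hΓ.surfLapVec_eq hx hV hA hw, hΓ.fderivWithin_apply hx (hV x hx) (hperp 1 (by decide)),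
    hΓ.fderivWithin_apply hx (hV x hx) (hperp 2 (by decide)),
    hΓ.surfDiv_eq (V := traction D Γ n u) hx hL hw, hLv, hLv, ht, hb]
  -- With B(n)wᵢ = B(wᵢ)n, trace-freeness of B(n) reads n·B(n,n) = -Σ B(wᵢ)n·wᵢ over the two tangent
  -- vectors. The vanishing of n·An then removes the curvature term from n·∇_s²q.
  rw [traceL_eq_inner _ w, hsymm (n x) (w 1), hsymm (n x) (w 2), hw] at htr
  rw [real_inner_comm] at hstretch
  simp only [inner_add_left, inner_add_right, inner_sub_right, real_inner_smul_right, map_smul,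
    real_inner_smul_left, inner_adjointL, hw, hstretch, mul_zero, sub_zero,
    real_inner_comm _ (fderivWithin ℝ u (D ∪ Γ) x _)] at htr ⊢
  rw [real_inner_comm] at htr
  linarith

theorem IsStokesFlow.hasFDerivWithinAt_pressure (hf : IsStokesFlow D Γ μ p u g)
    (h : IsSide D Γ ν) (hx : x ∈ Γ) :
    HasFDerivWithinAt p (innerSL ℝ (gradientWithin p (D ∪ Γ) x)) Γ x := by
  refine (h.hasFDerivWithinAt (hf.pressure_reg.of_le (by norm_num)) hx).congr_fderiv ?_
  rw [← toDual_gradientWithin]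
  rfl

theorem IsStokesFlow.hasFDerivWithinAt_gradient (hf : IsStokesFlow D Γ μ p u g)
    (h : IsSide D Γ ν) (hx : x ∈ Γ) :
    ∃ Q : E3 →L[ℝ] E3, HasFDerivWithinAt (gradientWithin p (D ∪ Γ)) Q Γ x ∧
      ∀ a b, inner ℝ (Q a) b = fderivWithin ℝ (fderivWithin ℝ p (D ∪ Γ)) (D ∪ Γ) x a b := by
  have h2 := (InnerProductSpace.toDual ℝ E3).symm.toContinuousLinearEquiv.hasFDerivAt
    |>.comp_hasFDerivWithinAt x
      (h.hasFDerivWithinAt (h.contDiffOn_fderivWithin hf.pressure_reg) hx)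
  refine ⟨_, h2, fun a b => ?_⟩
  simp [← InnerProductSpace.toDual_apply_apply (𝕜 := ℝ)]

/-- The stress vector in a fixed direction extends continuously to `Γ`. -/
theorem IsStokesFlow.continuousOn_stress (hf : IsStokesFlow D Γ μ p u g) (h : IsSide D Γ ν)
    (a : E3) : ContinuousOn (fun y => -(p y) • a + μ • (fderivWithin ℝ u (D ∪ Γ) y a
      + adjointL (fderivWithin ℝ u (D ∪ Γ) y) a)) (D ∪ Γ) := by
  have hA := h.continuousOn_fderivWithin (hf.velocity_reg.of_le (by norm_num))
  exact (hf.pressure_reg.continuousOn.neg.smul continuousOn_const).add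
    (((hA.clm_apply continuousOn_const).add
      ((adjointL.continuous.comp_continuousOn hA).clm_apply continuousOn_const)).const_smul μ)

theorem stressVec_eq (h : IsSide D Γ ν) (a : E3) {y : E3} (hy : y ∈ D) :
    stressVec μ p u a y = -(p y) • a + μ • (fderivWithin ℝ u (D ∪ Γ) y a
      + adjointL (fderivWithin ℝ u (D ∪ Γ) y) a) := by
  rw [stressVec, h.fderivWithin_eq hy, adjointL_apply]

end Flow

end StokesJump

end

/-! ### The jump conditions -/

open StokesJump in
theorem mainTheorem3
    (Ω Ωm : Set E3) (n : E3 → E3) (hΓ : IsInterface Ω Ωm n)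
    (μp μm : ℝ) (pp pm : E3 → ℝ) (up um gp gm q f : E3 → E3)
    -- the Stokes equations in each phase
    (hp : IsStokesFlow (outer Ω Ωm) (frontier Ωm) μp pp up gp)
    (hm : IsStokesFlow Ωm (frontier Ωm) μm pm um gm)
    -- continuity of the velocity and no slip: `q = u⁺ = u⁻` on the interface
    (hq : ∀ x ∈ frontier Ωm, up x = q x ∧ um x = q x)
    -- incompressibility of the interface
    (hinc : ∀ x ∈ frontier Ωm, surfDiv (frontier Ωm) n q x = 0)
    -- balance of stress: `(σ⁺ - σ⁻) n = f` on the interface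
    (hstress : ∀ x ∈ frontier Ωm,
      HasJump (stressVec μp pp up (n x)) (stressVec μm pm um (n x)) x (n x) (f x)) :
    -- the surface derivatives which occur below exist
    DifferentiableOn ℝ n (frontier Ωm) ∧
    DifferentiableOn ℝ f (frontier Ωm) ∧
    DifferentiableOn ℝ q (frontier Ωm) ∧
    (∀ i, SurfTwiceDifferentiable (frontier Ωm) n (fun y => q y i)) ∧
    SurfTwiceDifferentiable (frontier Ωm) n (fun y => inner ℝ (f y) (n y)) ∧
    ∀ x ∈ frontier Ωm, ∃ (Jpn Jpnn Jdivg : ℝ) (Jg : E3),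
      HasJump (dirDeriv (n x) pp) (dirDeriv (n x) pm) x (n x) Jpn ∧
      HasJump (dirDeriv (n x) (dirDeriv (n x) pp)) (dirDeriv (n x) (dirDeriv (n x) pm))
        x (n x) Jpnn ∧
      HasJump (divergence gp) (divergence gm) x (n x) Jdivg ∧
      HasJump gp gm x (n x) Jg ∧
      -- the jump in the second normal derivative of the pressure
      Jpnn = surfLap (frontier Ωm) n (fun y => inner ℝ (f y) (n y)) x + Jdivg
        - Jpn * totalCurvature (frontier Ωm) n x ∧
      -- the jump in the first normal derivative of the pressure
      ∀ (t b : E3) (κt κb : ℝ), IsPrincipalFrame (frontier Ωm) n x t b κt κb →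
        Jpn = 2 * (μp - μm) *
            (inner ℝ (n x) (surfLapVec (frontier Ωm) n q x)
              + κt * inner ℝ (fderivWithin ℝ q (frontier Ωm) x t) t
              + κb * inner ℝ (fderivWithin ℝ q (frontier Ωm) x b) b)
          - surfDiv (frontier Ωm) n f x
          + inner ℝ (f x) (n x) * totalCurvature (frontier Ωm) n x
          + inner ℝ Jg (n x) := by
  set Γ := frontier Ωm
  have hS : IsOrientedSurface Γ n := hΓ.isOrientedSurface
  have sp : IsSide (outer Ω Ωm) Γ n := hΓ.isSide_outer
  have sm : IsSide Ωm Γ (-n) := hΓ.isSide_inner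
  have hqp : ∀ y ∈ Γ, up y = q y := fun y hy => (hq y hy).1
  have hqm : ∀ y ∈ Γ, um y = q y := fun y hy => (hq y hy).2
  set Sp := outer Ω Ωm ∪ Γ with hSp
  set Sm := Ωm ∪ Γ with hSm
  -- For the fixed direction n(y) both stress vectors extend continuously to `Γ`, so uniqueness of
  -- the jump gives f pointwise. The factors 1 match the two-term form of
  -- `IsOrientedSurface.surfDiv_linear`.
  have hfeq : ∀ y ∈ Γ, f y = (1 : ℝ) • ((pm y - pp y) • n y)
      + (1 : ℝ) • (μp • traction (outer Ω Ωm) Γ n up y + (-μm) • traction Ωm Γ n um y) := by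
    intro y hy
    rw [(hstress y hy).unique (HasJump.of_isSide sp sm hy (hp.continuousOn_stress sp (n y))
      (hm.continuousOn_stress sm (n y)) (fun z hz => stressVec_eq sp (n y) hz)
      (fun z hz => stressVec_eq sm (n y) hz))]
    simp only [traction]
    module
  have hTp := fun y (hy : y ∈ Γ) => hp.differentiableWithinAt_traction hS sp hy
  have hTm := fun y (hy : y ∈ Γ) => hm.differentiableWithinAt_traction hS sm hy
  have hpp := fun y (hy : y ∈ Γ) => hp.hasFDerivWithinAt_pressure sp hy
  have hpm := fun y (hy : y ∈ Γ) => hm.hasFDerivWithinAt_pressure sm hy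
  have hψ : ∀ y ∈ Γ, DifferentiableWithinAt ℝ (fun y => pm y - pp y) Γ y := fun y hy =>
    (hpm y hy).differentiableWithinAt.sub (hpp y hy).differentiableWithinAt
  have hψn : ∀ y ∈ Γ, DifferentiableWithinAt ℝ (fun y => (pm y - pp y) • n y) Γ y := fun y hy =>
    (hψ y hy).smul (hS.differentiableOn_normal y hy)
  have hT : ∀ y ∈ Γ, DifferentiableWithinAt ℝ (fun y =>
      μp • traction (outer Ω Ωm) Γ n up y + (-μm) • traction Ωm Γ n um y) Γ y := fun y hy =>
    ((hTp y hy).const_smul μp).add ((hTm y hy).const_smul (-μm))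
  have hfdiff : DifferentiableOn ℝ f Γ := fun y hy =>
    (((hψn y hy).const_smul (1 : ℝ)).add ((hT y hy).const_smul (1 : ℝ))).congr
      hfeq (hfeq y hy)
  have hfn : ∀ y ∈ Γ, inner ℝ (f y) (n y) = pm y - pp y := by
    intro y hy
    rw [hfeq y hy]
    simp only [inner_add_left, real_inner_smul_left, real_inner_self_eq_norm_sq,
      hS.norm_normal y hy, hp.inner_traction_normal hS sp hqp hinc hy,
      hm.inner_traction_normal hS sm hqm hinc hy]
    ring
  -- The full one-sided gradients are kept: their normal part yields the term [∂p/∂n]H in the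
  -- surface Laplacian.
  have hF : ∀ y ∈ Γ, HasFDerivWithinAt (fun y => inner ℝ (f y) (n y))
      (innerSL ℝ (gradientWithin pm Sm y - gradientWithin pp Sp y)) Γ y := by
    intro y hy
    rw [map_sub]
    exact ((hpm y hy).sub (hpp y hy)).congr hfn (hfn y hy)
  have hG : DifferentiableOn ℝ (fun y => gradientWithin pm Sm y - gradientWithin pp Sp y) Γ := by
    intro y hy
    obtain ⟨Qp, hQp, -⟩ := hp.hasFDerivWithinAt_gradient sp hy
    obtain ⟨Qm, hQm, -⟩ := hm.hasFDerivWithinAt_gradient sm hy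
    exact (hQm.sub hQp).differentiableWithinAt
  have hqd := fun y (hy : y ∈ Γ) => hp.hasFDerivWithinAt_velocity sp hqp hy
  refine ⟨hS.differentiableOn_normal, hfdiff, fun y hy => (hqd y hy).differentiableWithinAt,
    fun i => ?_, hS.surfTwiceDifferentiable hF hG, fun x hx => ?_⟩
  · refine hS.surfTwiceDifferentiable (fun y hy => hasFDerivWithinAt_component (hqd y hy) i) ?_
    intro y hy
    have hA := sp.hasFDerivWithinAt (sp.contDiffOn_fderivWithin hp.velocity_reg) hy
    exact ((adjointL.hasFDerivAt.comp_hasFDerivWithinAt y hA).clm_apply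
      (hasFDerivWithinAt_const (e i) y Γ)).differentiableWithinAt
  have c1p := sp.continuousOn_fderivWithin (hp.pressure_reg.of_le (by norm_num))
  have c1m := sm.continuousOn_fderivWithin (hm.pressure_reg.of_le (by norm_num))
  have c2p := sp.continuousOn_fderivWithin (sp.contDiffOn_fderivWithin hp.pressure_reg)
  have c2m := sm.continuousOn_fderivWithin (sm.contDiffOn_fderivWithin hm.pressure_reg)
  have cgp := sp.continuousOn_fderivWithin hp.force_reg
  have cgm := sm.continuousOn_fderivWithin hm.force_reg
  have hgradp : ∀ v, fderivWithin ℝ pp Sp x v = inner ℝ (gradientWithin pp Sp x) v := fun v => by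
    rw [← InnerProductSpace.toDual_apply_apply (𝕜 := ℝ), toDual_gradientWithin]
  have hgradm : ∀ v, fderivWithin ℝ pm Sm x v = inner ℝ (gradientWithin pm Sm x) v := fun v => by
    rw [← InnerProductSpace.toDual_apply_apply (𝕜 := ℝ), toDual_gradientWithin]
  refine ⟨fderivWithin ℝ pp Sp x (n x) - fderivWithin ℝ pm Sm x (n x),
    fderivWithin ℝ (fderivWithin ℝ pp Sp) Sp x (n x) (n x)
      - fderivWithin ℝ (fderivWithin ℝ pm Sm) Sm x (n x) (n x),
    traceL (fderivWithin ℝ gp Sp x) - traceL (fderivWithin ℝ gm Sm x), gp x - gm x,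
    ?_, ?_, ?_, ?_, ?_, ?_⟩
  · exact HasJump.of_isSide sp sm hx (ψp := fun y => fderivWithin ℝ pp Sp y (n x))
      (ψm := fun y => fderivWithin ℝ pm Sm y (n x)) (c1p.clm_apply continuousOn_const)
      (c1m.clm_apply continuousOn_const) (fun y hy => by rw [dirDeriv, sp.fderivWithin_eq hy])
      (fun y hy => by rw [dirDeriv, sm.fderivWithin_eq hy])
  · exact HasJump.of_isSide sp sm hx
      (ψp := fun y => fderivWithin ℝ (fderivWithin ℝ pp Sp) Sp y (n x) (n x))
      (ψm := fun y => fderivWithin ℝ (fderivWithin ℝ pm Sm) Sm y (n x) (n x))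
      ((c2p.clm_apply continuousOn_const).clm_apply continuousOn_const)
      ((c2m.clm_apply continuousOn_const).clm_apply continuousOn_const)
      (fun y hy => by
        rw [dirDeriv_dirDeriv_eq sp.isOpen (hp.pressure_reg.mono subset_union_left) hy,
          sp.fderivWithin_fderivWithin_eq hy])
      (fun y hy => by
        rw [dirDeriv_dirDeriv_eq sm.isOpen (hm.pressure_reg.mono subset_union_left) hy,
          sm.fderivWithin_fderivWithin_eq hy])
  · exact HasJump.of_isSide sp sm hx (ψp := fun y => traceL (fderivWithin ℝ gp Sp y))
      (ψm := fun y => traceL (fderivWithin ℝ gm Sm y))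
      (traceL.continuous.comp_continuousOn cgp) (traceL.continuous.comp_continuousOn cgm)
      (fun y hy => by rw [divergence_eq_traceL, sp.fderivWithin_eq hy])
      (fun y hy => by rw [divergence_eq_traceL, sm.fderivWithin_eq hy])
  · exact HasJump.of_isSide sp sm hx hp.force_reg.continuousOn hm.force_reg.continuousOn
      (fun _ _ => rfl) (fun _ _ => rfl)
  · obtain ⟨w, hw⟩ := exists_orthonormalBasis_zero_eq (hS.norm_normal x hx)
    obtain ⟨Qp, hQp, hQp'⟩ := hp.hasFDerivWithinAt_gradient sp hx
    obtain ⟨Qm, hQm, hQm'⟩ := hm.hasFDerivWithinAt_gradient sm hx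
    have hlp := hp.laplacian_pressure sp w x (Or.inr hx)
    have hlm := hm.laplacian_pressure sm w x (Or.inr hx)
    -- With [∇·g] replaced by the jump of the full trace of the Hessian, the tangential parts cancel
    -- against the surface Laplacian of p⁻ - p⁺.
    rw [hS.surfLap_eq hx hF (hQm.sub hQp) hw, hgradp, hgradm, ← hlp, ← hlm, hw]
    simp only [sub_apply, inner_sub_left, inner_sub_right, hQp', hQm', real_inner_comm (n x)]
    ring
  · intro t b κt κb hfr
    obtain ⟨w, hw, rfl, rfl⟩ := exists_orthonormalBasis_eq (hS.norm_normal x hx) hfr.norm_t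
      hfr.norm_b hfr.t_perp_n hfr.b_perp_n hfr.t_perp_b
    have hlp := hp.inner_normal_laplacian hS sp hqp hinc hx hw hfr.deriv_t hfr.deriv_b
    have hlm := hm.inner_normal_laplacian hS sm hqm hinc hx hw hfr.deriv_t hfr.deriv_b
    -- The momentum balance is paired with n, and ∇_s·f is expanded as (f·n)H + μ⁺∇_s·T⁺ - μ⁻∇_s·T⁻,
    -- so the tractions cancel.
    rw [hgradp, hgradm, hp.momentum_boundary sp w x (Or.inr hx),
      hm.momentum_boundary sm w x (Or.inr hx), surfDiv_congr hx hfeq,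
      hS.surfDiv_linear hx (hψn x hx) (hT x hx), hS.surfDiv_linear hx (hTp x hx) (hTm x hx),
      hS.surfDiv_smul_normal hx (hψ x hx), hfn x hx, real_inner_comm (n x), real_inner_comm (n x),
      real_inner_comm (n x) (gp x - gm x)]
    simp only [inner_add_right (n x) (_ • _), inner_sub_right, real_inner_smul_right, hlp, hlm]
    ring
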